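/- Let $d\ge 0$ be an integer, let $\Omega=\mathbb T^d=\mathbb R^d/\mathbb Z^d$, and let $\phi,\psi\in C^1(\Omega)$ satisfy $\phi<\psi$ in $\Omega$. For $\varepsilon\in(0,1)$ and $p\in\mathbb R^d$ put $|p|_\varepsilon=\sqrt{\varepsilon^2+|p|^2}$, and for $x\in\Omega$, $s\in\mathbb R$ put $$V_\varepsilon(x,s)=\tfrac1\varepsilon(\phi(x)-s)_+^4+\tfrac1\varepsilon(s-\psi(x))_+^4 .$$ Let $u_\varepsilon\in C^1(\Omega)$, $\varepsilon\in(0,1)$, and let $u\in W^{1,\infty}(\Omega)$ (with weak gradient $\nabla u\in L^\infty(\Omega;\mathbb R^d)$). Set $$\nu_\varepsilon=-\frac{\nabla u_\varepsilon}{|\nabla u_\varepsilon|_\varepsilon},\qquad H_\varepsilon=\operatorname{div}\nu_\varepsilon,\qquad f_\varepsilon(x)=-\partial_sV_\varepsilon(x,u_\varepsilon(x)),$$ where the divergence is understood in the weak sense and is assumed to be an $L^1(\Omega)$ function. Assume that (A1) $\displaystyle\sup_{\varepsilon\in(0,1),\,x\in\Omega}\{|u_\varepsilon(x)|,|\nabla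 u_\varepsilon(x)|\}<\infty$; (A2) $u_\varepsilon\to u$ uniformly in $\Omega$ as $\varepsilon\to0^+$, and $\phi\le u\le\psi$ in $\Omega$; (A3) $\nabla u_\varepsilon\rightharpoonup\nabla u$ weakly-$\ast$ in $L^\infty(\Omega;\mathbb R^d)$ as $\varepsilon\to0^+$; (A4) $\displaystyle\sup_{\varepsilon\in(0,1)}\int_\Omega|-H_\varepsilon+f_\varepsilon|\,dx<\infty$. Then $|\nabla u_\varepsilon|\rightharpoonup|\nabla u|$ weakly-$\ast$ in $L^\infty(\Omega)$ as $\varepsilon\to0^+$. -/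

import Mathlib

open Set Filter Topology MeasureTheory

noncomputable section

namespace ObstacleMCF

/-- Euclidean space `ℝ^d`. Functions on the flat torus `𝕋^d = ℝ^d / ℤ^d` are represented by
`ℤ^d`-periodic functions on `ℝ^d`. -/
abbrev E (d : ℕ) : Type := EuclideanSpace ℝ (Fin d)

/-- `ℤ^d`-periodicity, i.e. `f` is a function on the torus `𝕋^d`. -/
def IsPeriodic {d : ℕ} {α : Type*} (f : E d → α) : Prop :=
  ∀ (k : Fin d → ℤ) (x : E d), f (x + WithLp.toLp 2 (fun i => (k i : ℝ))) = f x

/-- The fundamental cell `[0,1)^d` of the torus. -/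
def cell (d : ℕ) : Set (E d) := {x | ∀ i, x i ∈ Ico (0 : ℝ) 1}

/-- Lebesgue measure on the torus: Lebesgue measure on the fundamental cell. -/
def torusMeasure (d : ℕ) : Measure (E d) := volume.restrict (cell d)

/-- `f ∈ C¹(𝕋^d)`. -/
def IsC1Torus {d : ℕ} (f : E d → ℝ) : Prop :=
  IsPeriodic f ∧ ContDiff ℝ 1 f

/-- `u ∈ W^{1,∞}(𝕋^d)` with weak gradient `G ∈ L^∞(𝕋^d; ℝ^d)`. -/
structure IsW1Infty {d : ℕ} (u : E d → ℝ) (G : E d → E d) : Prop where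
  periodic : IsPeriodic u
  memLp : MemLp u ⊤ (torusMeasure d)
  memLp_grad : MemLp G ⊤ (torusMeasure d)
  weak_grad : ∀ ζ : E d → ℝ, IsC1Torus ζ → ∀ i : Fin d,
    ∫ x, G x i * ζ x ∂(torusMeasure d) = - ∫ x, u x * gradient ζ x i ∂(torusMeasure d)

/-- `h ∈ L¹(𝕋^d)` is the weak (distributional) divergence of the vector field `X`. -/
structure HasWeakDiv {d : ℕ} (X : E d → E d) (h : E d → ℝ) : Prop where
  integrable : Integrable h (torusMeasure d)
  weak_div : ∀ ζ : E d → ℝ, IsC1Torus ζ →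
    ∫ x, h x * ζ x ∂(torusMeasure d) = - ∫ x, inner ℝ (X x) (gradient ζ x) ∂(torusMeasure d)

/-- Weak-* convergence in `L^∞(𝕋^d; F)`, the dual space of `L¹(𝕋^d; F)`. -/
structure WeakStarTendsto {d : ℕ} {ι F : Type*} [NormedAddCommGroup F] [InnerProductSpace ℝ F]
    (g : ι → E d → F) (l : Filter ι) (g₀ : E d → F) : Prop where
  eventually_memLp : ∀ᶠ i in l, MemLp (g i) ⊤ (torusMeasure d)
  memLp_limit : MemLp g₀ ⊤ (torusMeasure d)
  tendsto_pairing : ∀ η : E d → F, Integrable η (torusMeasure d) →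
    Tendsto (fun i => ∫ x, inner ℝ (g i x) (η x) ∂(torusMeasure d)) l
      (𝓝 (∫ x, inner ℝ (g₀ x) (η x) ∂(torusMeasure d)))

/-- `|p|_ε = √(ε² + |p|²)`. -/
def regNorm {d : ℕ} (ε : ℝ) (p : E d) : ℝ := Real.sqrt (ε ^ 2 + ‖p‖ ^ 2)

/-- The regularized normal `ν_ε = -∇v / |∇v|_ε`. -/
def normal {d : ℕ} (ε : ℝ) (v : E d → ℝ) (x : E d) : E d :=
  -((regNorm ε (gradient v x))⁻¹ • gradient v x)

/-- The penalization potential `V_ε(s) = (φ(x) - s)₊⁴ / ε + (s - ψ(x))₊⁴ / ε` at the point `x`. -/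
def potential {d : ℕ} (ε : ℝ) (φ ψ : E d → ℝ) (x : E d) (s : ℝ) : ℝ :=
  1 / ε * (max (φ x - s) 0) ^ 4 + 1 / ε * (max (s - ψ x) 0) ^ 4

/-- The forcing term `f_ε = -V_ε'(v)`, the derivative being taken in `s`. -/
def forcing {d : ℕ} (ε : ℝ) (φ ψ : E d → ℝ) (v : E d → ℝ) (x : E d) : ℝ :=
  - deriv (potential ε φ ψ x) (v x)

end ObstacleMCF

end

namespace ObstacleMCF

/-! The only obstruction to convergence of the norms is loss of mass, so the key is `limsup ∫|∇u_ε|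
≤ ∫|∇u|`. Convexity of `|·|_ε` and the weak divergence, tested with `w - u_ε`, bound `∫|∇u_ε|` by
`∫|∇w|` plus small errors for every `C¹` function `w` between the obstacles and close to `u`
(`integral_norm_gradient_le`): the penalty term has a favourable sign, and (A4) controls the rest.

Such `w` exist with `∇w` close to `∇u` in `L¹` by Mazur's argument: convex combinations of the
`u_ε`, pushed slightly towards `(φ+ψ)/2` to satisfy the constraints
(`toLp_mem_closure_gradient_competitors`).

With `N = ∇u/|∇u|`, the defect `|∇u_ε| - ∇u_ε·N` is nonnegative and bounded, and its integral tends
to `0`; hence it vanishes weakly-*, while `∇u_ε·N` tends weakly-* to `|∇u|`. -/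

/-! ### Integration over the fundamental cell. -/

lemma measurableSet_cell (d : ℕ) : MeasurableSet (cell d) := by
  have : cell d = ⋂ i, (fun x : E d => x i) ⁻¹' Ico (0 : ℝ) 1 := by
    ext x; simp [cell]
  rw [this]
  exact MeasurableSet.iInter fun i =>
    (EuclideanSpace.proj (𝕜 := ℝ) i).continuous.measurable measurableSet_Ico

lemma exists_isCompact_cell_subset (d : ℕ) : ∃ K : Set (E d), IsCompact K ∧ cell d ⊆ K := by
  refine ⟨closure (cell d), Bornology.IsBounded.isCompact_closure ?_, subset_closure⟩
  refine isBounded_iff_forall_norm_le.2 ⟨Real.sqrt d, fun x hx => ?_⟩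
  rw [EuclideanSpace.norm_eq]
  refine Real.sqrt_le_sqrt ?_
  calc ∑ i, ‖x i‖ ^ 2 ≤ ∑ _i : Fin d, (1 : ℝ) := by
        refine Finset.sum_le_sum fun i _ => ?_
        have := hx i
        rw [Real.norm_eq_abs, sq_abs]
        nlinarith [this.1, this.2]
    _ = d := by simp

instance isFiniteMeasure_torusMeasure (d : ℕ) : IsFiniteMeasure (torusMeasure d) := by
  obtain ⟨K, hK, hc⟩ := exists_isCompact_cell_subset d
  exact ⟨by simpa [torusMeasure] using (measure_mono hc).trans_lt hK.measure_lt_top⟩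

lemma ae_mem_cell (d : ℕ) : ∀ᵐ x ∂(torusMeasure d), x ∈ cell d :=
  ae_restrict_mem (measurableSet_cell d)

lemma exists_norm_le_on_cell {d : ℕ} {F : Type*} [NormedAddCommGroup F] {g : E d → F}
    (hg : Continuous g) : ∃ C, 0 ≤ C ∧ ∀ x ∈ cell d, ‖g x‖ ≤ C := by
  obtain ⟨K, hK, hc⟩ := exists_isCompact_cell_subset d
  obtain ⟨C, hC⟩ := hK.exists_bound_of_continuousOn hg.continuousOn
  exact ⟨max C 0, le_max_right _ _, fun x hx => (hC x (hc hx)).trans (le_max_left _ _)⟩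

lemma memLp_of_continuous {d : ℕ} {F : Type*} [NormedAddCommGroup F]
    [SecondCountableTopologyEither (E d) F] {g : E d → F}
    (hg : Continuous g) (p : ENNReal) : MemLp g p (torusMeasure d) := by
  obtain ⟨C, -, hC⟩ := exists_norm_le_on_cell hg
  exact MemLp.of_bound hg.aestronglyMeasurable C ((ae_mem_cell d).mono hC)

lemma integrable_of_continuous {d : ℕ} {F : Type*} [NormedAddCommGroup F]
    [SecondCountableTopologyEither (E d) F] {g : E d → F}
    (hg : Continuous g) : Integrable g (torusMeasure d) :=
  memLp_one_iff_integrable.1 (memLp_of_continuous hg 1)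

lemma exists_pos_le_on_cell {d : ℕ} {g : E d → ℝ} (hg : Continuous g) (hpos : ∀ x, 0 < g x) :
    ∃ m, 0 < m ∧ ∀ x ∈ cell d, m ≤ g x := by
  obtain ⟨K, hK, hc⟩ := exists_isCompact_cell_subset d
  obtain ⟨m, hm, h⟩ := hK.exists_forall_le' hg.continuousOn (a := 0) fun x _ => hpos x
  exact ⟨m, hm, fun x hx => h x (hc hx)⟩

/-! ### Calculus of `C¹` functions on the torus. -/

lemma IsC1Torus.differentiableAt {d : ℕ} {g : E d → ℝ} (hg : IsC1Torus g) (x : E d) :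
    DifferentiableAt ℝ g x := hg.2.differentiable (by simp) x

lemma IsC1Torus.continuous_gradient {d : ℕ} {g : E d → ℝ} (hg : IsC1Torus g) :
    Continuous (gradient g) :=
  (InnerProductSpace.toDual ℝ (E d)).symm.continuous.comp (hg.2.continuous_fderiv (by simp))

lemma IsC1Torus.combo {d : ℕ} {g h : E d → ℝ} (hg : IsC1Torus g) (hh : IsC1Torus h)
    (a b : ℝ) : IsC1Torus (fun x => a * g x + b * h x) :=
  ⟨fun k x => by simp only [hg.1 k x, hh.1 k x],
    (contDiff_const.mul hg.2).add (contDiff_const.mul hh.2)⟩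

lemma IsC1Torus.gradient_combo {d : ℕ} {g h : E d → ℝ} (hg : IsC1Torus g) (hh : IsC1Torus h)
    (a b : ℝ) (x : E d) :
    gradient (fun x => a * g x + b * h x) x = a • gradient g x + b • gradient h x := by
  have h1 := (hg.differentiableAt x).hasFDerivAt.const_mul a
  have h2 := (hh.differentiableAt x).hasFDerivAt.const_mul b
  simp only [gradient]
  rw [(h1.fun_add h2).fderiv]
  simp

/-! ### The penalty forcing and its sign. -/

lemma hasDerivAt_max_zero_pow_four (s : ℝ) :
    HasDerivAt (fun t : ℝ => (max t 0) ^ 4) (4 * (max s 0) ^ 3) s := by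
  rcases lt_trichotomy s 0 with hs | rfl | hs
  · rw [max_eq_right hs.le]
    have : (fun t : ℝ => (max t 0) ^ 4) =ᶠ[𝓝 s] fun _ => 0 := by
      filter_upwards [Iio_mem_nhds hs] with t ht
      simp [max_eq_right (le_of_lt (mem_Iio.1 ht))]
    simpa using (hasDerivAt_const s (0 : ℝ)).congr_of_eventuallyEq this
  -- At the kink, `(max t 0) ^ 4` is dominated by `t ^ 4`, which is already `o(t)`.
  · have h : HasDerivAt (fun t : ℝ => t ^ 4) 0 0 := by simpa using hasDerivAt_pow 4 (0 : ℝ)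
    rw [hasDerivAt_iff_isLittleO] at h ⊢
    refine Asymptotics.IsBigO.trans_isLittleO (Asymptotics.IsBigO.of_bound 1 ?_) h
    refine Eventually.of_forall fun t => ?_
    rcases le_total t 0 with ht | ht <;> simp [ht]
  · rw [max_eq_left hs.le]
    have : (fun t : ℝ => (max t 0) ^ 4) =ᶠ[𝓝 s] fun t => t ^ 4 := by
      filter_upwards [Ioi_mem_nhds hs] with t ht
      rw [max_eq_left (le_of_lt (mem_Ioi.1 ht))]
    simpa using (hasDerivAt_pow 4 s).congr_of_eventuallyEq this

lemma forcing_eq {d : ℕ} (ε : ℝ) (φ ψ v : E d → ℝ) (x : E d) :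
    forcing ε φ ψ v x =
      1 / ε * (4 * (max (φ x - v x) 0) ^ 3) - 1 / ε * (4 * (max (v x - ψ x) 0) ^ 3) := by
  have h1 := ((hasDerivAt_max_zero_pow_four (φ x - v x)).comp (v x)
    ((hasDerivAt_id (v x)).const_sub (φ x))).const_mul (1 / ε)
  have h2 := ((hasDerivAt_max_zero_pow_four (v x - ψ x)).comp (v x)
    ((hasDerivAt_id (v x)).sub_const (ψ x))).const_mul (1 / ε)
  have h3 : HasDerivAt (potential ε φ ψ x) _ (v x) := h1.add h2
  rw [forcing, h3.deriv]
  ring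

/-- The penalty pushes `v` back between the obstacles, hence towards any admissible `w`; at most one
of its two terms is active. -/
lemma forcing_mul_nonneg {d : ℕ} {ε : ℝ} (hε : 0 < ε) {φ ψ v w : E d → ℝ} {x : E d}
    (h₁ : φ x ≤ w x) (h₂ : w x ≤ ψ x) : 0 ≤ forcing ε φ ψ v x * (w x - v x) := by
  rw [forcing_eq]
  have hε' : 0 < 1 / ε := by positivity
  rcases lt_or_ge (v x) (φ x) with h | h
  · rw [max_eq_right (a := v x - ψ x) (by linarith)]
    have : 0 ≤ w x - v x := by linarith
    simp only [ne_eq, OfNat.ofNat_ne_zero, not_false_eq_true, zero_pow, mul_zero, sub_zero]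
    positivity
  · rw [max_eq_right (a := φ x - v x) (by linarith)]
    rcases lt_or_ge (ψ x) (v x) with h' | h'
    · have h3 : 0 ≤ 1 / ε * (4 * (max (v x - ψ x) 0) ^ 3) := by positivity
      nlinarith
    · rw [max_eq_right (a := v x - ψ x) (by linarith)]
      simp

lemma continuous_forcing {d : ℕ} (ε : ℝ) {φ ψ v : E d → ℝ} (hφ : Continuous φ)
    (hψ : Continuous ψ) (hv : Continuous v) : Continuous (forcing ε φ ψ v) := by
  have : forcing ε φ ψ v = _ := funext (forcing_eq ε φ ψ v)
  rw [this]
  fun_prop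

/-! ### The regularized norm and the comparison inequality. -/

lemma regNorm_pos {d : ℕ} {ε : ℝ} (hε : 0 < ε) (p : E d) : 0 < regNorm ε p :=
  Real.sqrt_pos.2 (by positivity)

lemma norm_le_regNorm {d : ℕ} (ε : ℝ) (p : E d) : ‖p‖ ≤ regNorm ε p :=
  Real.le_sqrt_of_sq_le (by nlinarith [sq_nonneg ε])

lemma regNorm_le {d : ℕ} {ε : ℝ} (hε : 0 ≤ ε) (p : E d) : regNorm ε p ≤ ‖p‖ + ε :=
  Real.sqrt_le_iff.2 ⟨by positivity, by nlinarith [mul_nonneg hε (norm_nonneg p)]⟩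

/-- Convexity of `|·|_ε`, in subgradient form. -/
lemma regNorm_subgradient {d : ℕ} {ε : ℝ} (hε : 0 < ε) (p q : E d) :
    regNorm ε p ≤ regNorm ε q + inner ℝ (-((regNorm ε p)⁻¹ • p)) (q - p) := by
  have hp := regNorm_pos hε p
  have hq := regNorm_pos hε q
  have hp2 : regNorm ε p ^ 2 = ε ^ 2 + ‖p‖ ^ 2 := Real.sq_sqrt (by positivity)
  have hq2 : regNorm ε q ^ 2 = ε ^ 2 + ‖q‖ ^ 2 := Real.sq_sqrt (by positivity)
  have hin : inner ℝ p q ≤ ‖p‖ * ‖q‖ := real_inner_le_norm p q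
  -- Cauchy–Schwarz for the vectors `(ε, p)` and `(ε, q)`.
  have key : ε ^ 2 + inner ℝ p q ≤ regNorm ε p * regNorm ε q := by
    refine le_trans (add_le_add_right hin _) ?_
    refine abs_le_of_sq_le_sq' ?_ (by positivity) |>.2
    rw [mul_pow, hp2, hq2]
    nlinarith [sq_nonneg (ε * (‖p‖ - ‖q‖))]
  rw [inner_neg_left, inner_smul_left, inner_sub_right, real_inner_self_eq_norm_sq]
  simp only [conj_trivial]
  refine le_of_mul_le_mul_left ?_ hp
  have e : regNorm ε p * (regNorm ε q + -((regNorm ε p)⁻¹ * (inner ℝ p q - ‖p‖ ^ 2)))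
      = regNorm ε p * regNorm ε q - (inner ℝ p q - ‖p‖ ^ 2) := by
    field_simp
    ring
  rw [e]
  nlinarith

lemma continuous_regNorm {d : ℕ} (ε : ℝ) : Continuous (regNorm (d := d) ε) := by
  unfold regNorm
  fun_prop

lemma IsC1Torus.continuous_normal {d : ℕ} {ε : ℝ} (hε : 0 < ε) {v : E d → ℝ}
    (hv : IsC1Torus v) : Continuous (normal ε v) := by
  have h := hv.continuous_gradient
  exact ((((continuous_regNorm ε).comp h).inv₀ fun x => (regNorm_pos hε _).ne').smul h).neg

/-- Comparison of the total variation of `v` with that of an admissible competitor `w`. -/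
lemma integral_norm_gradient_le {d : ℕ} {φ ψ v w h : E d → ℝ} {ε C r : ℝ} (hε : 0 < ε)
    (hφ : IsC1Torus φ) (hψ : IsC1Torus ψ) (hv : IsC1Torus v) (hw : IsC1Torus w)
    (hh : HasWeakDiv (normal ε v) h)
    (hC : ∫ x, |-(h x) + forcing ε φ ψ v x| ∂(torusMeasure d) ≤ C)
    (hw' : ∀ x ∈ cell d, φ x ≤ w x ∧ w x ≤ ψ x) (hr : 0 ≤ r)
    (hwv : ∀ x ∈ cell d, |w x - v x| ≤ r) :
    ∫ x, ‖gradient v x‖ ∂(torusMeasure d) ≤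
      ∫ x, ‖gradient w x‖ ∂(torusMeasure d) + ε * (torusMeasure d).real univ + C * r := by
  set ζ : E d → ℝ := fun x => 1 * w x + (-1) * v x with hζ
  have hζ1 : IsC1Torus ζ := hw.combo hv 1 (-1)
  have hζg : ∀ x, gradient ζ x = gradient w x - gradient v x := fun x => by
    rw [hζ, hw.gradient_combo hv]; simp [sub_eq_add_neg]
  have hζx : ∀ x, ζ x = w x - v x := fun x => by simp only [hζ]; ring
  have hf := integrable_of_continuous
    (continuous_forcing ε hφ.2.continuous hψ.2.continuous hv.2.continuous)
  have hgv := hv.continuous_gradient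
  have hgw := hw.continuous_gradient
  have hbd : ∀ᵐ x ∂(torusMeasure d), ‖ζ x‖ ≤ r :=
    (ae_mem_cell d).mono fun x hx => by rw [hζx]; exact hwv x hx
  have hg : Integrable (fun x => -(h x) + forcing ε φ ψ v x) (torusMeasure d) :=
    hh.integrable.neg.add hf
  have hgζ : Integrable (fun x => (-(h x) + forcing ε φ ψ v x) * ζ x) (torusMeasure d) :=
    hg.mul_bdd hζ1.2.continuous.aestronglyMeasurable hbd
  have hfζ : Integrable (fun x => forcing ε φ ψ v x * ζ x) (torusMeasure d) :=
    hf.mul_bdd hζ1.2.continuous.aestronglyMeasurable hbd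
  have hν : Integrable (fun x => inner ℝ (normal ε v x) (gradient ζ x)) (torusMeasure d) :=
    integrable_of_continuous ((hv.continuous_normal hε).inner hζ1.continuous_gradient)
  have e1 : ∫ x, inner ℝ (normal ε v x) (gradient ζ x) ∂(torusMeasure d) =
      ∫ x, (-(h x) + forcing ε φ ψ v x) * ζ x ∂(torusMeasure d)
        - ∫ x, forcing ε φ ψ v x * ζ x ∂(torusMeasure d) := by
    rw [← integral_sub hgζ hfζ, ← neg_eq_iff_eq_neg.2 (hh.weak_div ζ hζ1), ← integral_neg]
    congr 1; ext x; ring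
  -- Only the sum `-h + f` is bounded in `L¹`; `f` alone is discarded by its sign.
  have e2 : 0 ≤ ∫ x, forcing ε φ ψ v x * ζ x ∂(torusMeasure d) :=
    integral_nonneg_of_ae <| (ae_mem_cell d).mono fun x hx => by
      simp only [Pi.zero_apply, hζx]; exact forcing_mul_nonneg hε (hw' x hx).1 (hw' x hx).2
  have e3 : ∫ x, (-(h x) + forcing ε φ ψ v x) * ζ x ∂(torusMeasure d) ≤ C * r := by
    refine le_trans ?_ (mul_le_mul_of_nonneg_right hC hr)
    rw [← integral_mul_const]
    refine integral_mono_ae hgζ (hg.abs.mul_const r) (hbd.mono fun x hx => ?_)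
    refine (le_abs_self _).trans ?_
    simp only [abs_mul]
    exact mul_le_mul_of_nonneg_left hx (abs_nonneg _)
  have hN : Integrable (fun x => ‖gradient w x‖ + ε) (torusMeasure d) :=
    integrable_of_continuous (by fun_prop)
  have e4 : ∫ x, ‖gradient v x‖ ∂(torusMeasure d) ≤
      ∫ x, (‖gradient w x‖ + ε) + inner ℝ (normal ε v x) (gradient ζ x) ∂(torusMeasure d) := by
    refine integral_mono (integrable_of_continuous hgv.norm) (hN.add hν) fun x => ?_
    refine (norm_le_regNorm ε _).trans ((regNorm_subgradient hε _ (gradient w x)).trans ?_)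
    simp only [hζg, normal]
    gcongr
    exact regNorm_le hε.le _
  rw [integral_add hN hν, integral_add (integrable_of_continuous hgw.norm)
    (integrable_const _), integral_const, smul_eq_mul, mul_comm _ ε] at e4
  linarith
-- Admissible competitors and Mazur's argument.
lemma mem_closure_of_forall_inner_le {X : Type*} [NormedAddCommGroup X] [InnerProductSpace ℝ X]
    [CompleteSpace X] {S : Set X} (hS : Convex ℝ S) {x : X}
    (h : ∀ (y : X) (a : ℝ), (∀ s ∈ S, inner ℝ y s ≤ a) → inner ℝ y x ≤ a) : x ∈ closure S := by
  by_contra hx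
  obtain ⟨f, a, hf, ha⟩ := geometric_hahn_banach_closed_point hS.closure isClosed_closure hx
  have := h ((InnerProductSpace.toDual ℝ X).symm f) a fun s hs => by
    rw [InnerProductSpace.toDual_symm_apply]
    exact (hf s (subset_closure hs)).le
  rw [InnerProductSpace.toDual_symm_apply] at this
  exact this.not_gt ha

/-- `C¹` functions lying between the obstacles and within `r` of `u`. -/
def competitors {d : ℕ} (φ ψ u : E d → ℝ) (r : ℝ) : Set (E d → ℝ) :=
  {w | IsC1Torus w ∧ ∀ x ∈ cell d, (φ x ≤ w x ∧ w x ≤ ψ x) ∧ |w x - u x| ≤ r}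

lemma competitors_combo {d : ℕ} {φ ψ u : E d → ℝ} {r : ℝ} {w₁ w₂ : E d → ℝ}
    (h₁ : w₁ ∈ competitors φ ψ u r) (h₂ : w₂ ∈ competitors φ ψ u r) {a b : ℝ} (ha : 0 ≤ a)
    (hb : 0 ≤ b) (hab : a + b = 1) :
    (fun x => a * w₁ x + b * w₂ x) ∈ competitors φ ψ u r := by
  refine ⟨h₁.1.combo h₂.1 a b, fun x hx => ?_⟩
  obtain ⟨⟨h1, h2⟩, h3⟩ := h₁.2 x hx
  obtain ⟨⟨k1, k2⟩, k3⟩ := h₂.2 x hx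
  rw [abs_le] at h3 k3 ⊢
  obtain rfl : b = 1 - a := by linarith
  refine ⟨⟨?_, ?_⟩, ?_, ?_⟩ <;> nlinarith

/-- Moving a fraction `θ` towards the midpoint of the obstacles gains a margin `θ * m / 2`, which
absorbs the uniform error `τ`. -/
lemma combo_mem_competitors {d : ℕ} {φ ψ u v : E d → ℝ} {r m M θ τ : ℝ} (hφ : IsC1Torus φ)
    (hψ : IsC1Torus ψ) (hu : ∀ x, φ x ≤ u x ∧ u x ≤ ψ x) (hv : IsC1Torus v)
    (hm : ∀ x ∈ cell d, m ≤ ψ x - φ x) (hM : ∀ x ∈ cell d, ψ x - φ x ≤ M)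
    (hθ : 0 ≤ θ) (hθ1 : θ ≤ 1) (hvu : ∀ x, |v x - u x| ≤ τ)
    (hτ : τ ≤ θ * m / 2) (hr : τ + θ * M ≤ r) :
    (fun x => (1 - θ) * v x + θ * (1 / 2 * φ x + 1 / 2 * ψ x)) ∈ competitors φ ψ u r := by
  refine ⟨hv.combo (hφ.combo hψ _ _) _ _, fun x hx => ?_⟩
  have h1 := hm x hx
  have h2 := hM x hx
  have h3 := hvu x
  have h0 : 0 ≤ τ := (abs_nonneg _).trans h3
  obtain ⟨h4, h5⟩ := hu x
  rw [abs_le] at h3 ⊢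
  have ht := sub_nonneg.2 hθ1
  have a1 := mul_le_mul_of_nonneg_left h3.1 ht
  have a2 := mul_le_mul_of_nonneg_left h3.2 ht
  have a3 := mul_le_mul_of_nonneg_left h4 ht
  have a4 := mul_le_mul_of_nonneg_left h5 ht
  have a5 := mul_le_mul_of_nonneg_left h1 hθ
  have a6 := mul_le_mul_of_nonneg_left h2 hθ
  have a7 := mul_le_mul_of_nonneg_left h4 hθ
  have a8 := mul_le_mul_of_nonneg_left h5 hθ
  have a9 := mul_nonneg hθ h0
  refine ⟨⟨?_, ?_⟩, ?_, ?_⟩ <;> nlinarith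

/-- The limit gradient is a strong `L²` limit of gradients of competitors. -/
lemma toLp_mem_closure_gradient_competitors {d : ℕ} {ι : Type*} {l : Filter ι} [l.NeBot]
    {φ ψ u : E d → ℝ} {v : ι → E d → ℝ} {G : E d → E d} {r : ℝ}
    (hφ : IsC1Torus φ) (hψ : IsC1Torus ψ) (hφψ : ∀ x, φ x < ψ x)
    (hu : ∀ x, φ x ≤ u x ∧ u x ≤ ψ x) (hv : ∀ᶠ i in l, IsC1Torus (v i))
    (hvu : TendstoUniformly v u l) (hG : WeakStarTendsto (fun i => gradient (v i)) l G)
    (hG2 : MemLp G 2 (torusMeasure d)) (hr : 0 < r) :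
    hG2.toLp G ∈ closure {g : Lp (E d) 2 (torusMeasure d) |
      ∃ w ∈ competitors φ ψ u r, g =ᵐ[torusMeasure d] gradient w} := by
  refine mem_closure_of_forall_inner_le ?_ fun y a hy => ?_
  · rintro g₁ ⟨w₁, hw₁, e₁⟩ g₂ ⟨w₂, hw₂, e₂⟩ a b ha hb hab
    refine ⟨_, competitors_combo hw₁ hw₂ ha hb hab, ?_⟩
    filter_upwards [e₁, e₂, Lp.coeFn_add (a • g₁) (b • g₂), Lp.coeFn_smul a g₁,
      Lp.coeFn_smul b g₂] with x h1 h2 h3 h4 h5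
    rw [h3, Pi.add_apply, h4, h5, Pi.smul_apply, Pi.smul_apply, h1, h2,
      hw₁.1.gradient_combo hw₂.1]
  · have hcont : Continuous fun x => ψ x - φ x := hψ.2.continuous.sub hφ.2.continuous
    obtain ⟨m, hm0, hm⟩ := exists_pos_le_on_cell hcont fun x => sub_pos.2 (hφψ x)
    obtain ⟨M, hM0, hM⟩ := exists_norm_le_on_cell hcont
    replace hM : ∀ x ∈ cell d, ψ x - φ x ≤ M := fun x hx => (le_abs_self _).trans (hM x hx)
    set χ : E d → ℝ := fun x => 1 / 2 * φ x + 1 / 2 * ψ x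
    have hχ : IsC1Torus χ := hφ.combo hψ _ _
    -- On a finite measure space `L² ⊆ L¹`, so `y` is a legitimate test field for weak-*
    -- convergence.
    have hyi : Integrable y (torusMeasure d) := (Lp.memLp y).integrable (by norm_num)
    have hpair : ∀ {w : E d → ℝ}, IsC1Torus w →
        Integrable (fun x => inner ℝ (gradient w x) (y x)) (torusMeasure d) := fun {w} hw => by
      have hL := memLp_of_continuous hw.continuous_gradient 2
      refine (L2.integrable_inner (𝕜 := ℝ) (hL.toLp _) y).congr (hL.coeFn_toLp.mono fun x hx => ?_)
      simp only [hx]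
    have hlim := hG.tendsto_pairing y hyi
    have hyG : inner ℝ y (hG2.toLp G) = ∫ x, inner ℝ (G x) (y x) ∂(torusMeasure d) := by
      rw [L2.inner_def]
      refine integral_congr_ae (hG2.coeFn_toLp.mono fun x hx => ?_)
      simp only [hx, real_inner_comm]
    rw [hyG]
    set A := ∫ x, inner ℝ (G x) (y x) ∂(torusMeasure d)
    set B := ∫ x, inner ℝ (gradient χ x) (y x) ∂(torusMeasure d)
    -- The limit in `i` is taken at fixed `θ > 0`, since the margin must beat the distance from `v
    -- i` to `u`; only then `θ → 0`.
    have step : ∀ θ : ℝ, 0 < θ → θ ≤ 1 → θ * M ≤ r / 2 → (1 - θ) * A + θ * B ≤ a := by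
      intro θ h0 h1 hθM
      refine le_of_tendsto ((hlim.const_mul (1 - θ)).add_const (θ * B)) ?_
      have hτ : 0 < min (r / 2) (θ * m / 2) := by positivity
      filter_upwards [hv, Metric.tendstoUniformly_iff.1 hvu _ hτ] with i hi hiu
      have hw := combo_mem_competitors (τ := min (r / 2) (θ * m / 2)) (r := r) hφ hψ hu hi hm hM
        h0.le h1 (fun x => by
          rw [← Real.dist_eq, dist_comm]; exact (hiu x).le) (min_le_right _ _)
          (by linarith [min_le_left (r / 2) (θ * m / 2)])
      have hL := memLp_of_continuous hw.1.continuous_gradient 2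
      refine le_trans (le_of_eq ?_) (hy (hL.toLp _) ⟨_, hw, hL.coeFn_toLp⟩)
      rw [L2.inner_def, ← integral_const_mul, ← integral_const_mul,
        ← integral_add ((hpair hi).const_mul _) ((hpair hχ).const_mul _)]
      refine integral_congr_ae (hL.coeFn_toLp.mono fun x hx => ?_)
      simp only [hx]
      rw [hi.gradient_combo hχ, real_inner_comm (_ + _) (y x), inner_add_left, inner_smul_left,
        inner_smul_left]
      simp
    have ht : Tendsto (fun θ : ℝ => (1 - θ) * A + θ * B) (𝓝[>] 0) (𝓝 A) := by
      have : Continuous fun θ : ℝ => (1 - θ) * A + θ * B := by fun_prop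
      simpa using (this.tendsto 0).mono_left nhdsWithin_le_nhds
    refine le_of_tendsto ht ?_
    have hcM : Tendsto (fun θ : ℝ => θ * M) (𝓝[>] 0) (𝓝 0) := by
      have : Continuous fun θ : ℝ => θ * M := by fun_prop
      simpa using (this.tendsto 0).mono_left nhdsWithin_le_nhds
    filter_upwards [self_mem_nhdsWithin, Ioc_mem_nhdsGT (zero_lt_one' ℝ),
      hcM.eventually (Iic_mem_nhds (half_pos hr))] with θ h0 h1 h2
    exact step θ h0 h1.2 h2

lemma exists_integral_norm_sub_le {α F : Type*} [MeasurableSpace α] {μ : Measure α}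
    [IsFiniteMeasure μ] [NormedAddCommGroup F] {S : Set (Lp F 2 μ)} {g : Lp F 2 μ}
    (hg : g ∈ closure S) {δ : ℝ} (hδ : 0 < δ) : ∃ s ∈ S, ∫ x, ‖s x - g x‖ ∂μ ≤ δ := by
  have hcont : Tendsto (fun t : ℝ => t * √(μ.real univ)) (𝓝 0) (𝓝 0) := by
    have : Continuous fun t : ℝ => t * √(μ.real univ) := by fun_prop
    simpa using this.tendsto 0
  obtain ⟨ρ, hρ0, hρ⟩ : ∃ ρ : ℝ, 0 < ρ ∧ ρ * √(μ.real univ) ≤ δ :=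
    ((eventually_mem_nhdsWithin (a := (0 : ℝ)) (s := Ioi 0)).and
      ((hcont.mono_left nhdsWithin_le_nhds).eventually (Iic_mem_nhds hδ))).exists
  obtain ⟨s, hs, hsg⟩ := Metric.mem_closure_iff.1 hg ρ hρ0
  refine ⟨s, hs, ?_⟩
  have hm := Lp.memLp (s - g)
  have h1 := eLpNorm_le_eLpNorm_mul_rpow_measure_univ (p := 1) (q := 2) (μ := μ) (by norm_num)
    hm.1
  have h2 := ENNReal.toReal_mono (ENNReal.mul_ne_top hm.2.ne
    (ENNReal.rpow_ne_top_of_nonneg (by norm_num) (measure_ne_top μ univ))) h1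
  rw [ENNReal.toReal_mul, ← Lp.norm_def, ← ENNReal.toReal_rpow] at h2
  have h3 : (eLpNorm (s - g : Lp F 2 μ) 1 μ).toReal = ∫ x, ‖s x - g x‖ ∂μ := by
    rw [eLpNorm_one_eq_lintegral_enorm, ← integral_norm_eq_lintegral_enorm hm.1]
    exact integral_congr_ae ((Lp.coeFn_sub s g).mono fun x hx => by simp only [hx, Pi.sub_apply])
  have h4 : (1 : ℝ) / (1 : ENNReal).toReal - 1 / (2 : ENNReal).toReal = 1 / 2 := by norm_num
  rw [h3, h4, ← Real.sqrt_eq_rpow] at h2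
  refine h2.trans (le_trans ?_ hρ)
  rw [dist_comm, dist_eq_norm] at hsg
  exact mul_le_mul_of_nonneg_right hsg.le (Real.sqrt_nonneg _)

/-- Nonnegative bounded functions whose integrals vanish in the limit vanish weakly-*. -/
lemma tendsto_integral_mul_of_tendsto_integral {α ι : Type*} [MeasurableSpace α] {μ : Measure α}
    [IsFiniteMeasure μ] {l : Filter ι} {a : ι → α → ℝ} {C : ℝ}
    (hC : ∀ᶠ i in l, Integrable (a i) μ ∧ (∀ᵐ x ∂μ, 0 ≤ a i x ∧ a i x ≤ C))
    (h0 : Tendsto (fun i => ∫ x, a i x ∂μ) l (𝓝 0)) {η : α → ℝ} (hη : Integrable η μ) :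
    Tendsto (fun i => ∫ x, a i x * η x ∂μ) l (𝓝 0) := by
  -- Truncation: `|η| ≤ n + (|η| - n)₊`, and the tail has small integral for large `n`.
  have hlim : Tendsto (fun n : ℕ => ∫ x, |C| * max (|η x| - n) 0 ∂μ) atTop (𝓝 0) := by
    have := tendsto_integral_of_dominated_convergence (μ := μ)
      (F := fun (n : ℕ) x => |C| * max (|η x| - n) 0) (f := fun _ => 0) (fun x => |C| * |η x|)
      (fun n => (((hη.1.norm.sub aestronglyMeasurable_const).sup
        aestronglyMeasurable_const).const_mul _)) (hη.abs.const_mul _) ?_ ?_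
    · simpa using this
    · refine fun n => Eventually.of_forall fun x => ?_
      rw [Real.norm_of_nonneg (by positivity)]
      gcongr
      exact max_le (by linarith [(Nat.cast_nonneg n : (0 : ℝ) ≤ n)]) (abs_nonneg _)
    · refine Eventually.of_forall fun x => tendsto_const_nhds.congr' ?_
      filter_upwards [eventually_ge_atTop ⌈|η x|⌉₊] with n hn
      rw [max_eq_right (by linarith [Nat.ceil_le.1 hn]), mul_zero]
  rw [Metric.tendsto_nhds]
  intro δ hδ
  obtain ⟨n, hn⟩ := (hlim.eventually (Iio_mem_nhds (half_pos hδ))).exists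
  have h1 : Tendsto (fun i => n * ∫ x, a i x ∂μ) l (𝓝 0) := by simpa using h0.const_mul (n : ℝ)
  filter_upwards [hC, h1.eventually (Iio_mem_nhds (half_pos hδ))] with i ⟨hi, hb⟩ h2
  have hmax : Integrable (fun x => |C| * max (|η x| - n) 0) μ :=
    ((hη.abs.sub (integrable_const _)).sup (integrable_const _)).const_mul _
  rw [dist_zero_right]
  calc ‖∫ x, a i x * η x ∂μ‖ ≤ ∫ x, (n * a i x + |C| * max (|η x| - n) 0) ∂μ := by
        refine norm_integral_le_of_norm_le ((hi.const_mul _).add hmax) (hb.mono fun x hx => ?_)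
        rw [norm_mul, Real.norm_of_nonneg hx.1, Real.norm_eq_abs]
        have h3 : |η x| ≤ n + max (|η x| - n) 0 := by linarith [le_max_left (|η x| - n) 0]
        have h4 : a i x ≤ |C| := hx.2.trans (le_abs_self C)
        have h5 := mul_le_mul_of_nonneg_left h3 hx.1
        have h6 := mul_le_mul_of_nonneg_right h4 (le_max_right (|η x| - n) 0)
        linarith
    _ < δ := by
        rw [integral_add (hi.const_mul _) hmax, integral_const_mul]
        linarith
lemma exists_competitor_integral_norm_le {d : ℕ} {ι : Type*} {l : Filter ι} [l.NeBot]
    {φ ψ u : E d → ℝ} {v : ι → E d → ℝ} {G : E d → E d} {r δ : ℝ}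
    (hφ : IsC1Torus φ) (hψ : IsC1Torus ψ) (hφψ : ∀ x, φ x < ψ x)
    (hu : ∀ x, φ x ≤ u x ∧ u x ≤ ψ x) (hv : ∀ᶠ i in l, IsC1Torus (v i))
    (hvu : TendstoUniformly v u l) (hG : WeakStarTendsto (fun i => gradient (v i)) l G)
    (hr : 0 < r) (hδ : 0 < δ) :
    ∃ w ∈ competitors φ ψ u r,
      ∫ x, ‖gradient w x‖ ∂(torusMeasure d) ≤ ∫ x, ‖G x‖ ∂(torusMeasure d) + δ := by
  have hG2 : MemLp G 2 (torusMeasure d) := hG.memLp_limit.mono_exponent le_top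
  obtain ⟨g, ⟨w, hw, hgw⟩, hg⟩ := exists_integral_norm_sub_le
    (toLp_mem_closure_gradient_competitors hφ hψ hφψ hu hv hvu hG hG2 hr) hδ
  refine ⟨w, hw, ?_⟩
  have hGi : Integrable G (torusMeasure d) := hG2.integrable (by norm_num)
  have hwi := integrable_of_continuous hw.1.continuous_gradient
  have e : ∫ x, ‖g x - hG2.toLp G x‖ ∂(torusMeasure d) =
      ∫ x, ‖gradient w x - G x‖ ∂(torusMeasure d) := by
    refine integral_congr_ae ?_
    filter_upwards [hgw, hG2.coeFn_toLp] with x h1 h2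
    rw [h1, h2]
  rw [e] at hg
  refine le_trans ?_ (add_le_add_right hg _)
  have hsub : Integrable (fun x => ‖gradient w x - G x‖) (torusMeasure d) := (hwi.sub hGi).norm
  rw [← integral_add hGi.norm hsub]
  exact integral_mono hwi.norm (hGi.norm.add hsub)
    fun x => norm_le_norm_add_norm_sub' _ _

end ObstacleMCF

open ObstacleMCF

/-! ### Vanishing of the defect and conclusion. -/

theorem mainTheorem4 {d : ℕ}
    -- the obstacles
    (φ ψ : ObstacleMCF.E d → ℝ)
    (hφ : ObstacleMCF.IsC1Torus φ) (hψ : ObstacleMCF.IsC1Torus ψ) (hφψ : ∀ x, φ x < ψ x)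
    -- the family `u_ε ∈ C¹`, the limit `u ∈ W^{1,∞}` with weak gradient `Du`
    (uε : ℝ → ObstacleMCF.E d → ℝ)
    (huε : ∀ ε ∈ Ioo (0 : ℝ) 1, ObstacleMCF.IsC1Torus (uε ε))
    (u : ObstacleMCF.E d → ℝ) (Du : ObstacleMCF.E d → ObstacleMCF.E d)
    (hu : ObstacleMCF.IsW1Infty u Du)
    -- `H_ε = div ν_ε` in the weak sense
    (H : ℝ → ObstacleMCF.E d → ℝ)
    (hH : ∀ ε ∈ Ioo (0 : ℝ) 1, ObstacleMCF.HasWeakDiv (ObstacleMCF.normal ε (uε ε)) (H ε))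
    (hA1 : ∃ C : ℝ, ∀ ε ∈ Ioo (0 : ℝ) 1, ∀ x, |uε ε x| ≤ C ∧ ‖gradient (uε ε) x‖ ≤ C)
    (hA2 : TendstoUniformly uε u (𝓝[>] 0))
    (hA2' : ∀ x, φ x ≤ u x ∧ u x ≤ ψ x)
    (hA3 : ObstacleMCF.WeakStarTendsto (fun ε => gradient (uε ε)) (𝓝[>] (0 : ℝ)) Du)
    (hA4 : ∃ C : ℝ, ∀ ε ∈ Ioo (0 : ℝ) 1,
      ∫ x, |-(H ε x) + ObstacleMCF.forcing ε φ ψ (uε ε) x| ∂(ObstacleMCF.torusMeasure d) ≤ C) :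
    ObstacleMCF.WeakStarTendsto (fun ε x => ‖gradient (uε ε) x‖) (𝓝[>] (0 : ℝ))
      (fun x => ‖Du x‖) := by
  obtain ⟨C, hC⟩ := hA1
  obtain ⟨C₄, hC₄⟩ := hA4
  have hI : ∀ᶠ ε in 𝓝[>] (0 : ℝ), ε ∈ Ioo (0 : ℝ) 1 := Ioo_mem_nhdsGT one_pos
  have hDui : Integrable Du (torusMeasure d) := hA3.memLp_limit.integrable le_top
  -- the direction field of `Du`
  set N : E d → E d := fun x => ‖Du x‖⁻¹ • Du x with hN
  have hNm : AEStronglyMeasurable N (torusMeasure d) :=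
    hDui.1.norm.aemeasurable.inv.aestronglyMeasurable.smul hDui.1
  have hN1 : ∀ x, ‖N x‖ ≤ 1 := fun x => by
    rw [hN, norm_smul, norm_inv, norm_norm]
    exact inv_mul_le_one
  -- Where `Du x = 0`, the convention `0⁻¹ = 0` makes `N x = 0`, so no case is lost.
  have hDuN : ∀ x, inner ℝ (Du x) (N x) = ‖Du x‖ := fun x => by
    simp only [hN, inner_smul_right, real_inner_self_eq_norm_sq]
    rcases eq_or_ne ‖Du x‖ 0 with h | h
    · simp [h]
    · field_simp
  have hNi : ∀ η : E d → ℝ, Integrable η (torusMeasure d) →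
      Integrable (fun x => η x • N x) (torusMeasure d) := fun η hη =>
    hη.norm.mono' (hη.1.smul hNm) <| Eventually.of_forall fun x => by
      rw [norm_smul]
      exact mul_le_of_le_one_right (norm_nonneg _) (hN1 x)
  have hin : ∀ ε ∈ Ioo (0 : ℝ) 1, ∀ x, |inner ℝ (gradient (uε ε) x) (N x)| ≤
      ‖gradient (uε ε) x‖ := fun ε _ x =>
    (abs_real_inner_le_norm _ _).trans (mul_le_of_le_one_right (norm_nonneg _) (hN1 x))
  have hgi : ∀ ε ∈ Ioo (0 : ℝ) 1, Integrable (fun x => ‖gradient (uε ε) x‖) (torusMeasure d) :=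
    fun ε hε => integrable_of_continuous (huε ε hε).continuous_gradient.norm
  have hini : ∀ ε ∈ Ioo (0 : ℝ) 1,
      Integrable (fun x => inner ℝ (gradient (uε ε) x) (N x)) (torusMeasure d) := fun ε hε =>
    (hgi ε hε).mono' ((huε ε hε).continuous_gradient.aestronglyMeasurable.inner hNm)
      (Eventually.of_forall (hin ε hε))
  set a : ℝ → E d → ℝ :=
    fun ε x => ‖gradient (uε ε) x‖ - inner ℝ (gradient (uε ε) x) (N x) with ha
  have hab : ∀ ε ∈ Ioo (0 : ℝ) 1, ∀ x, 0 ≤ a ε x ∧ a ε x ≤ 2 * C := fun ε hε x => by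
    have h1 := abs_le.1 (hin ε hε x)
    have h2 := (hC ε hε x).2
    constructor <;> simp only [ha] <;> linarith
  have hai : ∀ ε ∈ Ioo (0 : ℝ) 1, Integrable (a ε) (torusMeasure d) := fun ε hε =>
    (hgi ε hε).sub (hini ε hε)
  have hlow : Tendsto (fun ε => ∫ x, inner ℝ (gradient (uε ε) x) (N x) ∂(torusMeasure d))
      (𝓝[>] 0) (𝓝 (∫ x, ‖Du x‖ ∂(torusMeasure d))) := by
    simpa only [hDuN, one_smul] using hA3.tendsto_pairing _ (hNi (fun _ => 1) (integrable_const _))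
  have hlim : Tendsto (fun ε => ∫ x, a ε x ∂(torusMeasure d)) (𝓝[>] 0) (𝓝 0) := by
    rw [Metric.tendsto_nhds]
    intro δ hδ
    have hsmall : ∀ K : ℝ, ∃ r : ℝ, 0 < r ∧ K * (2 * r) < δ / 4 := fun K => by
      have hc : Continuous fun r : ℝ => K * (2 * r) := by fun_prop
      have ht : Tendsto (fun r : ℝ => K * (2 * r)) (𝓝[>] 0) (𝓝 0) := by
        simpa using (hc.tendsto 0).mono_left nhdsWithin_le_nhds
      exact ((eventually_mem_nhdsWithin (a := (0 : ℝ)) (s := Ioi 0)).and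
        (ht.eventually (Iio_mem_nhds (by positivity)))).exists
    -- Four errors of `δ / 4`: the `C₄` term, the competitor's gradient, `ε` times the volume, and
    -- the limit `hlow`. The factor `2 * r` adds `|w - u|` and `|u - u_ε|`.
    obtain ⟨r, hr, hrC⟩ := hsmall C₄
    obtain ⟨w, hw, hwint⟩ := exists_competitor_integral_norm_le hφ hψ hφψ hA2'
      (hI.mono huε) hA2 hA3 hr (show 0 < δ / 4 by positivity)
    have hvol : Tendsto (fun ε : ℝ => ε * (torusMeasure d).real univ) (𝓝[>] 0) (𝓝 0) := by
      have hc : Continuous fun ε : ℝ => ε * (torusMeasure d).real univ := by fun_prop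
      simpa using (hc.tendsto 0).mono_left nhdsWithin_le_nhds
    filter_upwards [hI, Metric.tendstoUniformly_iff.1 hA2 r hr,
      hvol.eventually (Iio_mem_nhds (show 0 < δ / 4 by positivity)),
      hlow.eventually (Ioi_mem_nhds (show _ - δ / 4 < _ from sub_lt_self _ (by positivity)))]
      with ε hε hur hvolε hlowε
    have hcmp := integral_norm_gradient_le (r := 2 * r) hε.1 hφ hψ (huε ε hε) hw.1 (hH ε hε)
      (hC₄ ε hε) (fun x hx => (hw.2 x hx).1) (by positivity) fun x hx => by
        have h1 := (hw.2 x hx).2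
        have h2 := (hur x).le
        rw [Real.dist_eq] at h2
        calc |w x - uε ε x| ≤ |w x - u x| + |u x - uε ε x| := abs_sub_le _ _ _
          _ ≤ 2 * r := by linarith
    rw [dist_zero_right, Real.norm_of_nonneg (integral_nonneg fun x => (hab ε hε x).1),
      integral_sub (hgi ε hε) (hini ε hε)]
    linarith
  refine ⟨hI.mono fun ε hε => memLp_of_continuous (huε ε hε).continuous_gradient.norm _,
    hA3.memLp_limit.norm, fun η hη => ?_⟩
  have h1 := tendsto_integral_mul_of_tendsto_integral
    (hI.mono fun ε hε => ⟨hai ε hε, Eventually.of_forall (hab ε hε)⟩) hlim hη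
  have h2 := h1.add (hA3.tendsto_pairing _ (hNi η hη))
  simp only [inner_smul_right, hDuN, zero_add] at h2
  have hlimit : ∫ x, inner ℝ ‖Du x‖ (η x) ∂(torusMeasure d) =
      ∫ x, η x * ‖Du x‖ ∂(torusMeasure d) := rfl
  rw [hlimit]
  refine h2.congr' (hI.mono fun ε hε => ?_)
  have i1 : Integrable (fun x => a ε x * η x) (torusMeasure d) :=
    hη.bdd_mul (hai ε hε).1 (c := 2 * C) (Eventually.of_forall fun x => by
      rw [Real.norm_of_nonneg (hab ε hε x).1]; exact (hab ε hε x).2)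
  have i2 : Integrable (fun x => η x * inner ℝ (gradient (uε ε) x) (N x)) (torusMeasure d) :=
    hη.mul_bdd (hini ε hε).1 (c := C) (Eventually.of_forall fun x =>
      (hin ε hε x).trans (hC ε hε x).2)
  rw [← integral_add i1 i2]
  refine integral_congr_ae (Eventually.of_forall fun x => ?_)
  change a ε x * η x + η x * inner ℝ (gradient (uε ε) x) (N x) = η x * ‖gradient (uε ε) x‖
  simp only [ha]
  ring
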